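/- All Hilbert spaces are finite-dimensional and nonzero. A quantum channel $\mathcal{N}_{C\to D}$ is a completely positive trace-preserving linear map taking operators on $\mathcal{H}_C$ to operators on $\mathcal{H}_D$; a state is a positive semi-definite operator of unit trace. For channels $\mathcal{N},\mathcal{M}$ from $C$ to $D$ let $$\|\mathcal{N}-\mathcal{M}\|_\diamond := \sup_{\rho_{RC}} \big\|(\mathrm{id}_R\otimes\mathcal{N})(\rho_{RC})-(\mathrm{id}_R\otimes\mathcal{M})(\rho_{RC})\big\|_1,$$ $$F(\mathcal{N},\mathcal{M}) := \inf_{\rho_{RC}} F\big((\mathrm{id}_R\otimes\mathcal{N})(\rho_{RC}),(\mathrm{id}_R\otimes\mathcal{M})(\rho_{RC})\big),$$ where the supremum and infimum range over all states $\rho_{RC}$ with a reference system $R$ of arbitrary finite dimension, $\|X\|_1 := \operatorname{Tr}\sqrt{X^\dagger X}$, and $F(\omega,\tau):=\|\sqrt{\omega}\sqrt{\tau}\|_1^2$ for states $\omega,\tau$. Let $\mathcal{N}_{\hat A\to\hat B}$ be a quantum channel, let $d\ge 1$, and let $A$ and $B$ be systems of dimension $d$, with identity channel $\mathrm{id}^d_{A\to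 B}$. Let $\mathrm{LOCR}$ be the set of superchannels $\Upsilon_{(\hat A\to\hat B)\to(A\to B)}$ (local operations and common randomness) of the form $$\Upsilon(\mathcal{M}_{\hat A\to\hat B})=\sum_{y} p(y)\,\mathcal{D}^y_{\hat B\to B}\circ\mathcal{M}_{\hat A\to\hat B}\circ\mathcal{E}^y_{A\to\hat A},$$ where $\{p(y)\}_y$ is a probability distribution on a finite alphabet and all $\mathcal{E}^y_{A\to\hat A}$ and $\mathcal{D}^y_{\hat B\to B}$ are quantum channels. Then the LOCR simulation errors of the identity channel defined from normalized diamond distance and from channel infidelity are equal: $$\inf_{\Upsilon\in\mathrm{LOCR}}\ \tfrac12\big\|\mathrm{id}^d_{A\to B}-\Upsilon(\mathcal{N}_{\hat A\to\hat B})\big\|_\diamond \;=\; \inf_{\Upsilon\in\mathrm{LOCR}}\ \Big[1-F\big(\mathrm{id}^d_{A\to B},\Upsilon(\mathcal{N}_{\hat A\to\hat B})\big)\Big].$$ -/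

import Mathlib

open scoped MatrixOrder ComplexOrder

noncomputable section

namespace QChan

/-- Linear maps from operators on `ℂ^α` to operators on `ℂ^β`, the operators being written as
matrices in the standard bases. -/
abbrev SuperOp (α β : Type*) := Matrix α α ℂ →ₗ[ℂ] Matrix β β ℂ

/-- A quantum state: a positive semi-definite operator of unit trace. -/
structure IsState {α : Type*} [Fintype α] (ρ : Matrix α α ℂ) : Prop where
  posSemidef : ρ.PosSemidef
  trace_eq_one : ρ.trace = 1

/-- The map `id_R ⊗ N`, acting on the second tensor factor of an operator on `R ⊗ α`. -/
def ampliation (R : Type*) {α β : Type*} (N : SuperOp α β)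
    (X : Matrix (R × α) (R × α) ℂ) : Matrix (R × β) (R × β) ℂ :=
  Matrix.of fun x y => N (Matrix.of fun a b => X (x.1, a) (y.1, b)) x.2 y.2

/-- Complete positivity: `id_R ⊗ N` is positive for every finite-dimensional `R`. -/
def IsCompletelyPositive {α β : Type*} [Fintype α] [Fintype β] (N : SuperOp α β) : Prop :=
  ∀ (r : ℕ) (X : Matrix (Fin r × α) (Fin r × α) ℂ),
    X.PosSemidef → (ampliation (Fin r) N X).PosSemidef

/-- Trace preservation. -/
def IsTracePreserving {α β : Type*} [Fintype α] [Fintype β] (N : SuperOp α β) : Prop :=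
  ∀ X : Matrix α α ℂ, (N X).trace = X.trace

/-- A quantum channel: a completely positive and trace-preserving map. -/
structure IsChannel {α β : Type*} [Fintype α] [Fintype β] (N : SuperOp α β) : Prop where
  completelyPositive : IsCompletelyPositive N
  tracePreserving : IsTracePreserving N

/-- The trace norm `‖X‖₁ = Tr √(X† X)`. -/
def traceNorm {α : Type*} [Fintype α] [DecidableEq α] (X : Matrix α α ℂ) : ℝ :=
  (CFC.sqrt (X.conjTranspose * X)).trace.re

/-- The fidelity of two states, `F(ω, τ) = ‖√ω √τ‖₁ ^ 2`. -/
def fidelity {α : Type*} [Fintype α] [DecidableEq α] (ω τ : Matrix α α ℂ) : ℝ :=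
  traceNorm (CFC.sqrt ω * CFC.sqrt τ) ^ 2

/-- The diamond distance of two channels: the supremum, over all finite-dimensional reference
systems `R` and all states `ρ` of `R ⊗ α`, of the trace distance of the two outputs. -/
def diamondDist {α β : Type*} [Fintype α] [Fintype β] [DecidableEq β]
    (N M : SuperOp α β) : ℝ :=
  sSup {t : ℝ | ∃ (r : ℕ) (ρ : Matrix (Fin r × α) (Fin r × α) ℂ), IsState ρ ∧
    t = traceNorm (ampliation (Fin r) N ρ - ampliation (Fin r) M ρ)}

/-- The channel fidelity: the infimum, over all finite-dimensional reference systems `R` and all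
states `ρ` of `R ⊗ α`, of the fidelity of the two outputs. -/
def channelFidelity {α β : Type*} [Fintype α] [Fintype β] [DecidableEq β]
    (N M : SuperOp α β) : ℝ :=
  sInf {t : ℝ | ∃ (r : ℕ) (ρ : Matrix (Fin r × α) (Fin r × α) ℂ), IsState ρ ∧
    t = fidelity (ampliation (Fin r) N ρ) (ampliation (Fin r) M ρ)}

/-- Superchannels `(α → β) → (γ → δ)` implementable by local operations and common randomness:
`Υ(N) = ∑ y, p(y) D^y ∘ N ∘ E^y` for a probability distribution `p` on a finite alphabet,
encoding channels `E^y : γ → α` and decoding channels `D^y : β → δ`. -/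
def LOCR (α β γ δ : Type*) [Fintype α] [Fintype β] [Fintype γ] [Fintype δ] :
    Set (SuperOp α β →ₗ[ℂ] SuperOp γ δ) :=
  {Υ | ∃ (k : ℕ) (p : Fin k → ℝ) (E : Fin k → SuperOp γ α) (D : Fin k → SuperOp β δ),
    (∀ y, 0 ≤ p y) ∧ ∑ y, p y = 1 ∧ (∀ y, IsChannel (E y)) ∧ (∀ y, IsChannel (D y)) ∧
    ∀ N : SuperOp α β, Υ N = ∑ y, (p y : ℂ) • (D y ∘ₗ N ∘ₗ E y)}

/-- The error, in normalized diamond distance, of simulating the `d`-dimensional identity channel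
by `Υ(N)`. -/
def simError {α β : Type*} (d : ℕ) (N : SuperOp α β)
    (Υ : SuperOp α β →ₗ[ℂ] SuperOp (Fin d) (Fin d)) : ℝ :=
  1 / 2 * diamondDist LinearMap.id (Υ N)

/-- The error, in channel infidelity, of simulating the `d`-dimensional identity channel
by `Υ(N)`. -/
def simErrorF {α β : Type*} (d : ℕ) (N : SuperOp α β)
    (Υ : SuperOp α β →ₗ[ℂ] SuperOp (Fin d) (Fin d)) : ℝ :=
  1 - channelFidelity LinearMap.id (Υ N)

/-- The LOCR simulation error defined from the normalized diamond distance. -/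
def errLOCR {α β : Type*} [Fintype α] [Fintype β] (d : ℕ) (N : SuperOp α β) : ℝ :=
  sInf (simError d N '' LOCR α β (Fin d) (Fin d))

/-- The LOCR simulation error defined from the channel infidelity. -/
def errLOCRF {α β : Type*} [Fintype α] [Fintype β] (d : ℕ) (N : SuperOp α β) : ℝ :=
  sInf (simErrorF d N '' LOCR α β (Fin d) (Fin d))

end QChan

end

/-! Both infima equal a third one, that of one minus the entanglement fidelity `f` of `Υ N`.
Evaluating either error on the maximally entangled state gives at least `1 - f`
(`one_sub_entFidelity_le_half_diamondDist`, `channelFidelity_id_le_entFidelity`). Conversely, LOCR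
is closed under twirling: shared randomness selects a Weyl unitary `U`, applied before encoding and
undone after decoding. If `K` is a Kraus operator of the simulated channel, the average of `Uᴴ * K *
U` is the scalar `d⁻¹ * tr K`, and `f` is the sum of the squared moduli of these scalars. Positivity
of a matrix variance (`smul_le_sum_conj`) then shows that the twirled output dominates `f • ρ` for
every input `ρ` (`entFidelity_smul_le_twirl`). This one operator inequality bounds both errors of
the twirled protocol by `1 - f`. -/

noncomputable section

namespace QChan

/-! ### Trace norm and fidelity -/

section TraceNorm

variable {ι : Type*} [Fintype ι] [DecidableEq ι]

lemma posSemidef_sqrt (X : Matrix ι ι ℂ) : (CFC.sqrt X).PosSemidef :=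
  Matrix.nonneg_iff_posSemidef.mp (CFC.sqrt_nonneg X)

/-- In an eigenbasis of `√(Xᴴ * X)`, column `i` of `X` has norm equal to the `i`-th eigenvalue,
which therefore bounds the `i`-th diagonal entry. -/
lemma re_trace_le_traceNorm (X : Matrix ι ι ℂ) : X.trace.re ≤ traceNorm X := by
  have hpsd : (CFC.sqrt (X.conjTranspose * X)).PosSemidef := (posSemidef_sqrt _)
  have hsq : CFC.sqrt (X.conjTranspose * X) * CFC.sqrt (X.conjTranspose * X) =
      X.conjTranspose * X :=
    CFC.sqrt_mul_sqrt_self _ (Matrix.posSemidef_conjTranspose_mul_self X).nonneg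
  unfold traceNorm
  generalize CFC.sqrt (X.conjTranspose * X) = H at hpsd hsq
  set U : Matrix ι ι ℂ := hpsd.1.eigenvectorUnitary.1 with hU
  set l := hpsd.1.eigenvalues with hl
  have hUU : U * star U = 1 := Unitary.coe_mul_star_self _
  have hUU' : star U * U = 1 := Unitary.coe_star_mul_self _
  have hdiag : star U * H * U = Matrix.diagonal (fun i => (l i : ℂ)) := by
    have h := hpsd.1.spectral_theorem
    rw [Unitary.conjStarAlgAut_apply] at h
    rw [h]
    simp only [← hU, ← hl]
    calc star U * (U * Matrix.diagonal (RCLike.ofReal ∘ l) * star U) * U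
        = (star U * U) * Matrix.diagonal (RCLike.ofReal ∘ l) * (star U * U) := by
          simp only [mul_assoc]
      _ = _ := by rw [hUU', one_mul, mul_one]; rfl
  set Y := star U * X * U with hY
  have htr : X.trace = Y.trace := by
    rw [hY, Matrix.trace_mul_comm, ← mul_assoc, hUU, one_mul]
  have hYY : star Y * Y = Matrix.diagonal (fun i => ((l i : ℂ) * l i)) := by
    calc star Y * Y = star U * (star X * (U * star U) * X) * U := by
          simp only [hY, star_mul, star_star, mul_assoc]
      _ = star U * (H * (U * star U) * H) * U := by
          rw [hUU, mul_one, mul_one, hsq]; rfl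
      _ = (star U * H * U) * (star U * H * U) := by simp only [mul_assoc]
      _ = _ := by rw [hdiag, Matrix.diagonal_mul_diagonal]
  rw [htr, hpsd.1.trace_eq_sum_eigenvalues]
  simp only [Matrix.trace, Matrix.diag, Complex.re_sum]
  refine Finset.sum_le_sum fun i _ => ?_
  have hi := congrFun (congrFun hYY i) i
  rw [Matrix.mul_apply, Matrix.diagonal_apply_eq] at hi
  have hi' := congrArg Complex.re hi
  simp only [Complex.re_sum, Matrix.star_apply] at hi'
  have hle : (star (Y i i) * Y i i).re ≤ ∑ k, (star (Y k i) * Y k i).re :=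
    Finset.single_le_sum (f := fun k => (star (Y k i) * Y k i).re)
      (fun k _ => by simp [Complex.mul_re]; nlinarith [sq_nonneg (Y k i).re, sq_nonneg (Y k i).im])
      (Finset.mem_univ i)
  rw [hi'] at hle
  simp only [Complex.star_def, Complex.mul_re, Complex.conj_re, Complex.conj_im,
    Complex.ofReal_re, Complex.ofReal_im] at hle
  change (Y i i).re ≤ l i
  have := hpsd.eigenvalues_nonneg i
  refine le_of_sq_le_sq ?_ this
  nlinarith [sq_nonneg (Y i i).im]

lemma re_trace_mul_le_traceNorm {W : Matrix ι ι ℂ} (hW : W.conjTranspose * W = 1)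
    (X : Matrix ι ι ℂ) : (W * X).trace.re ≤ traceNorm X := by
  refine (re_trace_le_traceNorm (W * X)).trans_eq ?_
  unfold traceNorm
  rw [Matrix.conjTranspose_mul, mul_assoc, ← mul_assoc _ W, hW, one_mul]

/-- In an eigenbasis of `A - B` each eigenvalue is a difference of nonnegative diagonal entries of
`A` and `B`, so its modulus is at most their sum. -/
lemma traceNorm_sub_le {A B : Matrix ι ι ℂ} (hA : A.PosSemidef) (hB : B.PosSemidef) :
    traceNorm (A - B) ≤ A.trace.re + B.trace.re := by
  have hD : (A - B).IsHermitian := hA.1.sub hB.1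
  set U : Matrix ι ι ℂ := hD.eigenvectorUnitary.1 with hU
  set l := hD.eigenvalues with hl
  have hUU : U * star U = 1 := Unitary.coe_mul_star_self _
  have hUU' : star U * U = 1 := Unitary.coe_star_mul_self _
  have hspec : A - B = U * Matrix.diagonal (fun i => (l i : ℂ)) * star U := by
    have h := hD.spectral_theorem
    rwa [Unitary.conjStarAlgAut_apply] at h
  set P : Matrix ι ι ℂ := Matrix.diagonal (fun i => ((|l i| : ℝ) : ℂ)) with hP
  have hPP : P.PosSemidef :=
    Matrix.PosSemidef.diagonal (fun i => by simp)
  have hsqrt : CFC.sqrt ((A - B).conjTranspose * (A - B)) = U * P * star U := by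
    refine CFC.sqrt_unique ?_ (hPP.mul_mul_conjTranspose_same U).nonneg
    rw [hD.eq, hspec]
    calc U * P * star U * (U * P * star U) = U * (P * (star U * U) * P) * star U := by
          simp only [mul_assoc]
      _ = U * (Matrix.diagonal (fun i => (l i : ℂ)) * (star U * U) *
            Matrix.diagonal (fun i => (l i : ℂ))) * star U := by
          rw [hUU', mul_one, mul_one, hP, Matrix.diagonal_mul_diagonal,
            Matrix.diagonal_mul_diagonal]
          simp only [← Complex.ofReal_mul, abs_mul_abs_self]
      _ = _ := by simp only [mul_assoc]
  have htr (Z : Matrix ι ι ℂ) : (star U * Z * U).trace = Z.trace := by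
    rw [Matrix.trace_mul_comm, ← mul_assoc, hUU, one_mul]
  have hdiag : star U * A * U - star U * B * U = Matrix.diagonal (fun i => (l i : ℂ)) := by
    rw [← sub_mul, ← mul_sub, hspec]
    calc _ = (star U * U) * Matrix.diagonal (fun i => (l i : ℂ)) * (star U * U) := by
          simp only [mul_assoc]
      _ = _ := by rw [hUU', one_mul, mul_one]
  have hA' : (star U * A * U).PosSemidef := hA.conjTranspose_mul_mul_same U
  have hB' : (star U * B * U).PosSemidef := hB.conjTranspose_mul_mul_same U
  unfold traceNorm
  rw [hsqrt, Matrix.trace_mul_comm, ← mul_assoc, hUU', one_mul, ← htr A, ← htr B]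
  simp only [Matrix.trace, Matrix.diag, Complex.re_sum, ← Finset.sum_add_distrib]
  refine Finset.sum_le_sum fun i _ => ?_
  have hi := congrArg Complex.re (congrFun (congrFun hdiag i) i)
  have ha := (Complex.le_def.mp (hA'.diag_nonneg (i := i))).1
  have hb := (Complex.le_def.mp (hB'.diag_nonneg (i := i))).1
  simp only [Matrix.sub_apply, Matrix.diagonal_apply_eq, Complex.sub_re, Complex.ofReal_re,
    Complex.zero_re] at hi ha hb
  rw [hP, Matrix.diagonal_apply_eq, Complex.ofReal_re, ← hi, abs_le]
  constructor <;> linarith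

/-- `ω - τ` is the difference of the positive operators `(1 - f) • ω` and `τ - f • ω`, each of trace
`1 - f`. -/
lemma traceNorm_sub_le_of_smul_le {ω τ : Matrix ι ι ℂ} (hω : IsState ω) (hτ : IsState τ)
    {f : ℝ} (hf : f ≤ 1) (h : (f : ℂ) • ω ≤ τ) : traceNorm (ω - τ) ≤ 2 * (1 - f) := by
  have hA : (((1 - f : ℝ) : ℂ) • ω).PosSemidef :=
    hω.posSemidef.smul (Complex.zero_le_real.mpr (sub_nonneg.mpr hf))
  have hB : (τ - (f : ℂ) • ω).PosSemidef := h
  have key := traceNorm_sub_le hA hB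
  have e : ((1 - f : ℝ) : ℂ) • ω - (τ - (f : ℂ) • ω) = ω - τ := by
    push_cast; rw [sub_smul, one_smul]; abel
  rw [e] at key
  simp only [Matrix.trace_sub, Matrix.trace_smul, hω.trace_eq_one, hτ.trace_eq_one] at key
  simp at key
  linarith

-- The operator norm supplies the C⋆-algebra structure behind operator monotonicity of the square
-- root.
open scoped Matrix.Norms.L2Operator in
lemma matrix_sqrt_le_sqrt {ω τ : Matrix ι ι ℂ} (h : ω ≤ τ) : CFC.sqrt ω ≤ CFC.sqrt τ :=
  CFC.sqrt_le_sqrt ω τ h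

/-- Operator monotonicity gives `√f • √ω ≤ √τ`; pairing with `√ω` under the trace gives `√f ≤ Re Tr
(√ω * √τ)`, which the trace norm bounds. -/
lemma le_fidelity_of_smul_le {ω τ : Matrix ι ι ℂ} (hω : IsState ω)
    {f : ℝ} (hf : 0 ≤ f) (h : (f : ℂ) • ω ≤ τ) : f ≤ fidelity ω τ := by
  set S := CFC.sqrt ω with hS
  have hSp : S.PosSemidef := (posSemidef_sqrt ω)
  have hSS : S * S = ω := CFC.sqrt_mul_sqrt_self _ hω.posSemidef.nonneg
  have hs : CFC.sqrt ((f : ℂ) • ω) = ((√f : ℝ) : ℂ) • S := by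
    refine CFC.sqrt_unique ?_ (hSp.smul (by simp [Real.sqrt_nonneg])).nonneg
    rw [smul_mul_smul_comm, hSS, ← Complex.ofReal_mul, Real.mul_self_sqrt hf]
  have hle : (((√f : ℝ) : ℂ) • S) ≤ CFC.sqrt τ := hs ▸ matrix_sqrt_le_sqrt h
  have hpsd : (CFC.sqrt τ - ((√f : ℝ) : ℂ) • S).PosSemidef := hle
  have hT := (hpsd.mul_mul_conjTranspose_same (CFC.sqrt S))
  have hQ : (CFC.sqrt S).IsHermitian := (posSemidef_sqrt S).1
  have hQQ : CFC.sqrt S * CFC.sqrt S = S := CFC.sqrt_mul_sqrt_self _ hSp.nonneg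
  have htr := (Complex.le_def.mp hT.trace_nonneg).1
  rw [hQ.eq, Matrix.trace_mul_comm, ← mul_assoc, hQQ, mul_sub, mul_smul_comm, hSS,
    Matrix.trace_sub, Matrix.trace_smul, hω.trace_eq_one] at htr
  simp at htr
  have h1 := re_trace_le_traceNorm (S * CFC.sqrt τ)
  unfold fidelity
  rw [← hS]
  calc f = √f ^ 2 := (Real.sq_sqrt hf).symm
    _ ≤ _ := pow_le_pow_left₀ (Real.sqrt_nonneg f) (htr.trans h1) 2

/-- The fidelity with a pure state is the expectation of that state. -/
lemma fidelity_vecMulVec {φ : ι → ℂ} (hφ : star φ ⬝ᵥ φ = 1) {σ : Matrix ι ι ℂ}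
    (hσ : σ.PosSemidef) :
    fidelity (Matrix.vecMulVec φ (star φ)) σ = (star φ ⬝ᵥ σ.mulVec φ).re := by
  set P := Matrix.vecMulVec φ (star φ) with hP
  have hPpsd : P.PosSemidef := Matrix.posSemidef_vecMulVec_self_star φ
  have hPP : P * P = P := by
    rw [hP, Matrix.vecMulVec_mul_vecMulVec, hφ, one_smul]
  set S := CFC.sqrt σ with hS
  have hSp : S.PosSemidef := (posSemidef_sqrt σ)
  have hSS : S * S = σ := CFC.sqrt_mul_sqrt_self _ hσ.nonneg
  have hPs : CFC.sqrt P = P := CFC.sqrt_unique hPP hPpsd.nonneg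
  set v := S.mulVec φ with hv
  have hX : (P * S).conjTranspose * (P * S) = Matrix.vecMulVec v (star v) := by
    rw [Matrix.conjTranspose_mul, hPpsd.1.eq, mul_assoc, ← mul_assoc P, hPP, hP,
      Matrix.vecMulVec_mul, Matrix.mul_vecMulVec, hSp.1.eq, hv, Matrix.star_mulVec, hSp.1.eq]
  have hvv : star v ⬝ᵥ v = star φ ⬝ᵥ σ.mulVec φ := by
    rw [hv, Matrix.star_mulVec, hSp.1.eq, ← Matrix.dotProduct_mulVec, Matrix.mulVec_mulVec, hSS]
  have hnn : 0 ≤ star v ⬝ᵥ v := dotProduct_star_self_nonneg v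
  obtain ⟨c, hc0, hc⟩ : ∃ c : ℝ, 0 ≤ c ∧ star v ⬝ᵥ v = ((c * c : ℝ) : ℂ) := by
    refine ⟨√(star v ⬝ᵥ v).re, Real.sqrt_nonneg _, ?_⟩
    rw [Real.mul_self_sqrt (Complex.le_def.mp hnn).1]
    exact Complex.ext rfl (Complex.le_def.mp hnn).2.symm
  -- Here `c` is the norm of `v`. If `c = 0` then `v = 0`, so the convention `0⁻¹ = 0` is harmless.
  have hsq : CFC.sqrt (Matrix.vecMulVec v (star v)) =
      ((c⁻¹ : ℝ) : ℂ) • Matrix.vecMulVec v (star v) := by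
    refine CFC.sqrt_unique ?_
      ((Matrix.posSemidef_vecMulVec_self_star v).smul (by simpa using hc0)).nonneg
    rcases eq_or_ne c 0 with h0 | h0
    · have : v = 0 := by
        rw [← dotProduct_star_self_eq_zero, hc, h0]; simp
      simp [this]
    · rw [smul_mul_smul_comm, Matrix.vecMulVec_mul_vecMulVec, hc, Matrix.vecMulVec_smul, smul_smul]
      convert one_smul ℂ _
      norm_cast
      field_simp
  unfold fidelity traceNorm
  rw [hPs, ← hS, hX, hsq, Matrix.trace_smul, Matrix.trace_vecMulVec, dotProduct_comm,
    ← hvv, hc]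
  simp only [smul_eq_mul, ← Complex.ofReal_mul, Complex.ofReal_re]
  rcases eq_or_ne c 0 with h0 | h0
  · simp [h0]
  · field_simp

/-- Test `P - σ` against the reflection `2P - 1`. -/
lemma two_mul_one_sub_le_traceNorm {φ : ι → ℂ} (hφ : star φ ⬝ᵥ φ = 1) {σ : Matrix ι ι ℂ}
    (hσ : σ.trace = 1) :
    2 * (1 - (star φ ⬝ᵥ σ.mulVec φ).re) ≤ traceNorm (Matrix.vecMulVec φ (star φ) - σ) := by
  set P := Matrix.vecMulVec φ (star φ) with hP
  have hPpsd : P.PosSemidef := Matrix.posSemidef_vecMulVec_self_star φ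
  have hPP : P * P = P := by
    rw [hP, Matrix.vecMulVec_mul_vecMulVec, hφ, one_smul]
  have htrP : P.trace = 1 := by rw [hP, Matrix.trace_vecMulVec, dotProduct_comm, hφ]
  have hW : (P + P - 1).conjTranspose * (P + P - 1) = 1 := by
    simp only [Matrix.conjTranspose_sub, Matrix.conjTranspose_add, hPpsd.1.eq,
      Matrix.conjTranspose_one]
    simp only [mul_sub, sub_mul, mul_add, add_mul, hPP, one_mul, mul_one]
    abel
  have key := re_trace_mul_le_traceNorm hW (P - σ)
  have htr : (P * σ).trace = star φ ⬝ᵥ σ.mulVec φ := by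
    rw [hP, Matrix.trace_mul_comm, Matrix.mul_vecMulVec, Matrix.trace_vecMulVec, dotProduct_comm]
  refine le_trans (le_of_eq ?_) key
  simp only [mul_sub, sub_mul, add_mul, hPP, one_mul, Matrix.trace_sub, Matrix.trace_add, htr,
    htrP, hσ]
  simp
  ring

end TraceNorm

/-! ### Conjugation maps and ampliations -/

open scoped Kronecker Matrix

/-- The map `X ↦ K X K†`. -/
def conjMap {α β : Type*} [Fintype α] (K : Matrix β α ℂ) : SuperOp α β where
  toFun X := K * X * Kᴴ
  map_add' X Y := by rw [Matrix.mul_add, Matrix.add_mul]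
  map_smul' c X := by simp

lemma conjMap_apply {α β : Type*} [Fintype α] (K : Matrix β α ℂ) (X : Matrix α α ℂ) :
    conjMap K X = K * X * Kᴴ := rfl

section Ampliation

variable {R α β γ : Type*}

lemma ampliation_id (X : Matrix (R × α) (R × α) ℂ) :
    ampliation R (LinearMap.id : SuperOp α α) X = X := rfl

lemma ampliation_sum {ι : Type*} (s : Finset ι) (N : ι → SuperOp α β)
    (X : Matrix (R × α) (R × α) ℂ) :
    ampliation R (∑ i ∈ s, N i) X = ∑ i ∈ s, ampliation R (N i) X := by
  ext x y
  simp [ampliation, Matrix.sum_apply]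

lemma ampliation_smul (c : ℂ) (N : SuperOp α β) (X : Matrix (R × α) (R × α) ℂ) :
    ampliation R (c • N) X = c • ampliation R N X := by
  ext x y
  simp [ampliation]

lemma ampliation_conjMap [Fintype R] [DecidableEq R] [Fintype α] (K : Matrix β α ℂ)
    (X : Matrix (R × α) (R × α) ℂ) :
    ampliation R (conjMap K) X =
      ((1 : Matrix R R ℂ) ⊗ₖ K) * X * ((1 : Matrix R R ℂ) ⊗ₖ K)ᴴ := by
  ext ⟨r, x⟩ ⟨s, y⟩
  simp [ampliation, conjMap_apply, Matrix.mul_apply, Fintype.sum_prod_type, Matrix.one_apply,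
    Matrix.conjTranspose_apply, Finset.sum_mul, apply_ite]

lemma trace_ampliation [Fintype R] [Fintype α] [Fintype β] {N : SuperOp α β}
    (hN : IsTracePreserving N) (X : Matrix (R × α) (R × α) ℂ) : (ampliation R N X).trace = X.trace := by
  simp only [Matrix.trace, Fintype.sum_prod_type, Matrix.diag]
  exact Finset.sum_congr rfl fun r _ => hN (Matrix.of fun a b => X (r, a) (r, b))

end Ampliation

/-! ### Closure properties of channels, Kraus operators, matrix variance -/

section Channels

variable {α β γ δ : Type*} [Fintype α] [Fintype β] [Fintype γ] [Fintype δ]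

lemma IsChannel.isState_ampliation {N : SuperOp α β} (hN : IsChannel N) {r : ℕ}
    {ρ : Matrix (Fin r × α) (Fin r × α) ℂ} (hρ : IsState ρ) :
    IsState (ampliation (Fin r) N ρ) :=
  ⟨hN.completelyPositive r ρ hρ.posSemidef,
    (trace_ampliation hN.tracePreserving ρ).trans hρ.trace_eq_one⟩

lemma IsChannel.comp {D : SuperOp β γ} {N : SuperOp α β} (hD : IsChannel D) (hN : IsChannel N) :
    IsChannel (D ∘ₗ N) :=
  ⟨fun r X hX => hD.completelyPositive r _ (hN.completelyPositive r X hX),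
    fun X => (hD.tracePreserving _).trans (hN.tracePreserving X)⟩

lemma IsChannel.sum_smul {ι : Type*} [Fintype ι] {p : ι → ℝ} (hp : ∀ i, 0 ≤ p i)
    (hp1 : ∑ i, p i = 1) {N : ι → SuperOp α β} (hN : ∀ i, IsChannel (N i)) :
    IsChannel (∑ i, (p i : ℂ) • N i) := by
  refine ⟨fun r X hX => ?_, fun X => ?_⟩
  · rw [ampliation_sum]
    refine Matrix.posSemidef_sum _ fun i _ => ?_
    rw [ampliation_smul]
    exact ((hN i).completelyPositive r X hX).smul (Complex.zero_le_real.mpr (hp i))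
  · simp only [LinearMap.sum_apply, LinearMap.smul_apply, Matrix.trace_sum, Matrix.trace_smul,
      (hN _).tracePreserving X, smul_eq_mul, ← Finset.sum_mul]
    rw [← Complex.ofReal_sum, hp1, Complex.ofReal_one, one_mul]

lemma isChannel_conjMap [DecidableEq α] {K : Matrix β α ℂ} (hK : Kᴴ * K = 1) :
    IsChannel (conjMap K) := by
  refine ⟨fun r X hX => ?_, fun X => ?_⟩
  · rw [ampliation_conjMap]
    exact hX.mul_mul_conjTranspose_same _
  · rw [conjMap_apply, Matrix.trace_mul_comm, ← Matrix.mul_assoc, hK, Matrix.one_mul]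

lemma isChannel_of_mem_LOCR {Υ : SuperOp α β →ₗ[ℂ] SuperOp γ δ} (hΥ : Υ ∈ LOCR α β γ δ)
    {N : SuperOp α β} (hN : IsChannel N) : IsChannel (Υ N) := by
  obtain ⟨k, p, E, D, hp, hp1, hE, hD, h⟩ := hΥ
  rw [h]
  exact IsChannel.sum_smul hp hp1 fun y => (hD y).comp (hN.comp (hE y))

lemma mem_LOCR_of_fintype {ι : Type*} [Fintype ι] {p : ι → ℝ} {E : ι → SuperOp γ α}
    {D : ι → SuperOp β δ} (hp : ∀ y, 0 ≤ p y) (hp1 : ∑ y, p y = 1)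
    (hE : ∀ y, IsChannel (E y)) (hD : ∀ y, IsChannel (D y))
    {Υ : SuperOp α β →ₗ[ℂ] SuperOp γ δ}
    (hΥ : ∀ N : SuperOp α β, Υ N = ∑ y, (p y : ℂ) • (D y ∘ₗ N ∘ₗ E y)) : Υ ∈ LOCR α β γ δ := by
  let e := (Fintype.equivFin ι).symm
  refine ⟨Fintype.card ι, p ∘ e, E ∘ e, D ∘ e, fun y => hp _, ?_, fun y => hE _, fun y => hD _,
    fun N => ?_⟩
  · rw [← hp1]; exact e.sum_comp p
  · rw [hΥ]; exact (e.sum_comp fun y => (p y : ℂ) • (D y ∘ₗ N ∘ₗ E y)).symm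

/-- The Kraus decomposition of a completely positive map. -/
lemma exists_kraus {d : ℕ} {M : SuperOp (Fin d) β} (hM : IsCompletelyPositive M) :
    ∃ K : Fin d × β → Matrix β (Fin d) ℂ, M = ∑ k, conjMap (K k) := by
  classical
  -- The unnormalized maximally entangled vector; its image under the ampliation is the Choi matrix
  -- of `M`.
  let v : Fin d × Fin d → ℂ := fun x => if x.1 = x.2 then 1 else 0
  have hJ := hM d _ (Matrix.posSemidef_vecMulVec_self_star v)
  obtain ⟨B, hB⟩ : ∃ B : Matrix (Fin d × β) (Fin d × β) ℂ,
      ampliation (Fin d) M (Matrix.vecMulVec v (star v)) = Bᴴ * B := by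
    refine ⟨CFC.sqrt (ampliation (Fin d) M (Matrix.vecMulVec v (star v))), ?_⟩
    rw [(posSemidef_sqrt _).1.eq, CFC.sqrt_mul_sqrt_self _ hJ.nonneg]
  -- Each row of the square root of the Choi matrix, conjugated and reshaped, is a Kraus operator.
  refine ⟨fun k => Matrix.of fun x i => star (B k (i, x)), ?_⟩
  refine Matrix.ext_linearMap ℂ fun i j => ?_
  ext1
  ext x y
  have h := congrFun (congrFun hB (i, x)) (j, y)
  have hE : (Matrix.of fun a b => Matrix.vecMulVec v (star v) (i, a) (j, b)) =
      Matrix.single i j (1 : ℂ) := by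
    ext a b
    by_cases h1 : i = a <;> by_cases h2 : j = b <;>
      simp [v, Matrix.vecMulVec_apply, h1, h2]
  simp only [ampliation, Matrix.of_apply, hE] at h
  have hsingle (K : Matrix β (Fin d) ℂ) :
      (K * Matrix.single i j (1 : ℂ) * Kᴴ) x y = K x i * star (K y j) := by
    rw [Matrix.mul_assoc, Matrix.mul_apply, Finset.sum_eq_single i]
    · simp
    · intro b _ hb
      simp [Matrix.single_mul_apply_of_ne _ _ _ _ _ hb]
    · simp
  simp [h, Matrix.mul_apply (M := Bᴴ), Matrix.sum_apply, conjMap_apply,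
    -Matrix.conjTranspose_apply, hsingle]
  rfl

/-- The average of `A ρ A†` dominates its value at the average of `A`. -/
lemma smul_le_sum_conj [DecidableEq α] {ι : Type*} [Fintype ι] {p : ι → ℝ} (hp : ∀ i, 0 ≤ p i)
    (hp1 : ∑ i, p i = 1) {A : ι → Matrix α α ℂ} {c : ℂ} (hA : ∑ i, (p i : ℂ) • A i = c • 1)
    {ρ : Matrix α α ℂ} (hρ : ρ.PosSemidef) :
    ((Complex.normSq c : ℝ) : ℂ) • ρ ≤ ∑ i, (p i : ℂ) • (A i * ρ * (A i)ᴴ) := by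
  have hpc : ∑ i, (p i : ℂ) = 1 := by rw [← Complex.ofReal_sum, hp1, Complex.ofReal_one]
  have hA' : ∑ i, (p i : ℂ) • (A i)ᴴ = star c • 1 := by
    have := congrArg Matrix.conjTranspose hA
    simpa [Matrix.conjTranspose_sum, Matrix.conjTranspose_smul] using this
  -- A variance with respect to the mean `c • 1`: expanding it leaves the second moment minus `|c|²
  -- • ρ`.
  have h : (∑ i, (p i : ℂ) • ((A i - c • 1) * ρ * (A i - c • 1)ᴴ)).PosSemidef :=
    Matrix.posSemidef_sum _ fun i _ =>
      (hρ.mul_mul_conjTranspose_same _).smul (Complex.zero_le_real.mpr (hp i))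
  suffices hsum : ∑ i, (p i : ℂ) • (A i * ρ * (A i)ᴴ) - ((Complex.normSq c : ℝ) : ℂ) • ρ =
      ∑ i, (p i : ℂ) • ((A i - c • 1) * ρ * (A i - c • 1)ᴴ) by
    rw [Matrix.le_iff, hsum]
    exact h
  have e (i : ι) : (p i : ℂ) • ((A i - c • 1) * ρ * (A i - c • 1)ᴴ) =
      (p i : ℂ) • (A i * ρ * (A i)ᴴ) - star c • (((p i : ℂ) • A i) * ρ)
        - c • (ρ * ((p i : ℂ) • (A i)ᴴ)) + (p i : ℂ) • ((c * star c) • ρ) := by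
    simp only [Matrix.conjTranspose_sub, Matrix.conjTranspose_smul, Matrix.conjTranspose_one,
      sub_mul, mul_sub, smul_mul_assoc, mul_smul_comm, one_mul, mul_one, smul_sub, smul_smul]
    rw [mul_comm (star c) (p i : ℂ), mul_comm c (p i : ℂ), mul_comm (star c) c]
    abel
  simp only [e, Finset.sum_add_distrib, Finset.sum_sub_distrib, ← Finset.smul_sum,
    ← Finset.sum_mul, ← Finset.mul_sum, ← Finset.sum_smul, hA, hA', hpc]
  simp only [smul_mul_assoc, mul_smul_comm, one_mul, mul_one, smul_smul]
  rw [Complex.normSq_eq_conj_mul_self, Complex.star_def, mul_comm c]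
  abel

end Channels

/-! ### Weyl operators and twirling -/

section Twirl

/-- The Weyl operators on functions on a finite ring, with respect to an additive character. -/
def weyl {R : Type*} [CommRing R] [DecidableEq R] (ψ : AddChar R ℂ) (z : R × R) :
    Matrix R R ℂ := Matrix.of fun i j => if i = j + z.1 then ψ (j * z.2) else 0

section

variable {R : Type*} [CommRing R] [Fintype R] [DecidableEq R] (ψ : AddChar R ℂ)

lemma weyl_conj_apply (z : R × R) (K : Matrix R R ℂ) (i j : R) :
    ((weyl ψ z)ᴴ * K * weyl ψ z) i j = ψ (z.2 * (j - i)) * K (i + z.1) (j + z.1) := by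
  have h1 : ψ (z.2 * (j - i)) = star (ψ (i * z.2)) * ψ (j * z.2) := by
    rw [Complex.star_def, ← AddChar.map_neg_eq_conj, ← AddChar.map_add_eq_mul]
    congr 1; ring
  rw [h1]
  simp [Matrix.mul_apply, weyl, Matrix.conjTranspose_apply, apply_ite, ite_mul]
  ring

lemma weyl_conjTranspose_mul_self (z : R × R) : (weyl ψ z)ᴴ * weyl ψ z = 1 := by
  ext i j
  have := weyl_conj_apply ψ z 1 i j
  rw [mul_one] at this
  rw [this]
  by_cases h : i = j <;> simp [h, Matrix.one_apply]

/-- Summing over the phase `z.2` kills the off-diagonal entries by character orthogonality; summing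
over the shift `z.1` turns each diagonal entry into a trace. -/
lemma sum_weyl_conj {ψ : AddChar R ℂ} (hψ : ψ.IsPrimitive) (K : Matrix R R ℂ) :
    ∑ z, (weyl ψ z)ᴴ * K * weyl ψ z = ((Fintype.card R : ℂ) * K.trace) • 1 := by
  ext i j
  rw [Matrix.sum_apply, Fintype.sum_prod_type]
  simp only [weyl_conj_apply, ← Finset.sum_mul, AddChar.sum_mulShift _ hψ, sub_eq_zero]
  by_cases h : j = i
  · subst h
    simp only [if_true, ← Finset.mul_sum]
    have := Equiv.sum_comp (Equiv.addLeft j) fun a => K a a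
    simp only [Equiv.coe_addLeft] at this
    simp [Matrix.trace, this]
  · simp [h, Ne.symm h]

end

/-- The conjugations by the Weyl operators form a unitary one-design. -/
lemma exists_unitary_design (d : ℕ) [NeZero d] :
    ∃ U : ZMod d × ZMod d → Matrix (Fin d) (Fin d) ℂ, (∀ z, (U z)ᴴ * U z = 1) ∧
      ∀ K : Matrix (Fin d) (Fin d) ℂ,
        ∑ z, (U z)ᴴ * K * U z = ((d : ℂ) * K.trace) • 1 := by
  let e : Fin d ≃ ZMod d := (ZMod.finEquiv d).toEquiv
  refine ⟨fun z => (weyl ZMod.stdAddChar z).submatrix e e, fun z => ?_, fun K => ?_⟩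
  · rw [Matrix.conjTranspose_submatrix, Matrix.submatrix_mul_equiv, weyl_conjTranspose_mul_self,
      Matrix.submatrix_one_equiv]
  · have h := sum_weyl_conj (ZMod.isPrimitive_stdAddChar d) (K.submatrix e.symm e.symm)
    have hK : K = (K.submatrix e.symm e.symm).submatrix e e := by simp
    have htr : (K.submatrix e.symm e.symm).trace = K.trace :=
      e.symm.sum_comp fun i => K i i
    rw [htr, ZMod.card] at h
    have h' := congrArg (fun X => X.submatrix e e) h
    conv_lhs => rw [hK]
    simp only [Matrix.conjTranspose_submatrix, Matrix.submatrix_mul_equiv]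
    ext i j
    have h'' := congrFun (congrFun h' i) j
    simpa [Matrix.sum_apply, Matrix.one_apply] using h''

/-- The average of the conjugates of a superoperator by a family of matrices. -/
def twirl {ι κ : Type*} [Fintype ι] [Fintype κ] (U : κ → Matrix ι ι ℂ) :
    SuperOp ι ι →ₗ[ℂ] SuperOp ι ι where
  toFun M := ∑ z, ((((Fintype.card κ : ℝ)⁻¹ : ℝ)) : ℂ) • (conjMap (U z)ᴴ ∘ₗ M ∘ₗ conjMap (U z))
  map_add' M M' := by
    simp only [LinearMap.add_comp, LinearMap.comp_add, smul_add, Finset.sum_add_distrib]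
  map_smul' c M := by
    simp only [LinearMap.smul_comp, LinearMap.comp_smul, RingHom.id_apply, Finset.smul_sum,
      smul_comm c]

/-- Common randomness is essential here: encoder and decoder must use the same `z`, which joins the
alphabet of the given protocol. -/
lemma twirl_comp_mem_LOCR {α β ι κ : Type*} [Fintype α] [Fintype β] [Fintype ι] [DecidableEq ι]
    [Fintype κ] [Nonempty κ] {U : κ → Matrix ι ι ℂ} (hU : ∀ z, (U z)ᴴ * U z = 1)
    {Υ : SuperOp α β →ₗ[ℂ] SuperOp ι ι} (hΥ : Υ ∈ LOCR α β ι ι) :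
    twirl U ∘ₗ Υ ∈ LOCR α β ι ι := by
  obtain ⟨k, p, E, D, hp, hp1, hE, hD, h⟩ := hΥ
  refine mem_LOCR_of_fintype (ι := κ × Fin k)
    (p := fun z => (Fintype.card κ : ℝ)⁻¹ * p z.2) (E := fun z => E z.2 ∘ₗ conjMap (U z.1))
    (D := fun z => conjMap (U z.1)ᴴ ∘ₗ D z.2) (fun z => mul_nonneg (by positivity) (hp _)) ?_
    (fun z => (hE _).comp (isChannel_conjMap (hU _))) (fun z => (isChannel_conjMap ?_).comp (hD _))
    fun N => ?_
  · simp [Fintype.sum_prod_type, ← Finset.mul_sum, hp1]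
  · rw [Matrix.conjTranspose_conjTranspose, mul_eq_one_comm, hU]
  · rw [Fintype.sum_prod_type]
    refine Finset.sum_congr rfl fun z _ => ?_
    rw [h]
    ext1 X
    simp only [LinearMap.smul_apply, LinearMap.comp_apply, LinearMap.sum_apply, map_sum, map_smul,
      Finset.smul_sum, smul_smul, Complex.ofReal_mul]

end Twirl

/-! ### Entanglement fidelity -/

/-- The maximally entangled unit vector. -/
def maxEnt (d : ℕ) : Fin d × Fin d → ℂ := fun x => if x.1 = x.2 then (((√d)⁻¹ : ℝ) : ℂ) else 0

/-- The entanglement fidelity. -/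
def entFidelity {d : ℕ} (M : SuperOp (Fin d) (Fin d)) : ℝ :=
  (star (maxEnt d) ⬝ᵥ (ampliation (Fin d) M
    (Matrix.vecMulVec (maxEnt d) (star (maxEnt d)))).mulVec (maxEnt d)).re

section EntFidelity

lemma dotProduct_maxEnt {d : ℕ} (K : Matrix (Fin d) (Fin d) ℂ) :
    star (maxEnt d) ⬝ᵥ (((1 : Matrix (Fin d) (Fin d) ℂ) ⊗ₖ K).mulVec (maxEnt d)) =
      (d : ℂ)⁻¹ * K.trace := by
  have h : (((√(d : ℝ))⁻¹ : ℝ) : ℂ) * (((√(d : ℝ))⁻¹ : ℝ) : ℂ) = (d : ℂ)⁻¹ := by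
    rw [← Complex.ofReal_mul, ← mul_inv, Real.mul_self_sqrt (Nat.cast_nonneg d)]
    push_cast; rfl
  simp [dotProduct, Matrix.mulVec, Fintype.sum_prod_type, maxEnt, Matrix.one_apply, apply_ite,
    Matrix.trace, ← h, Finset.mul_sum, -Complex.ofReal_inv]
  refine Finset.sum_congr rfl fun i _ => by ring

variable {d : ℕ} [NeZero d]

lemma star_maxEnt_dotProduct : star (maxEnt d) ⬝ᵥ maxEnt d = 1 := by
  have h := dotProduct_maxEnt (1 : Matrix (Fin d) (Fin d) ℂ)
  rw [Matrix.one_kronecker_one, Matrix.one_mulVec] at h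
  rw [h]
  simp [NeZero.ne]

lemma isState_maxEnt : IsState (Matrix.vecMulVec (maxEnt d) (star (maxEnt d))) :=
  ⟨Matrix.posSemidef_vecMulVec_self_star _, by
    rw [Matrix.trace_vecMulVec, dotProduct_comm, star_maxEnt_dotProduct]⟩

lemma entFidelity_sum_conjMap {d : ℕ} {ι : Type*} [Fintype ι] (K : ι → Matrix (Fin d) (Fin d) ℂ) :
    entFidelity (∑ k, conjMap (K k)) = ∑ k, Complex.normSq ((d : ℂ)⁻¹ * (K k).trace) := by
  unfold entFidelity
  rw [ampliation_sum, Matrix.sum_mulVec, dotProduct_sum, Complex.re_sum]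
  refine Finset.sum_congr rfl fun k _ => ?_
  rw [ampliation_conjMap, Matrix.mul_vecMulVec, Matrix.vecMulVec_mul, ← Matrix.star_mulVec,
    Matrix.vecMulVec_mulVec, ← dotProduct_maxEnt]
  rw [dotProduct_smul]
  set w := ((1 : Matrix (Fin d) (Fin d) ℂ) ⊗ₖ K k).mulVec (maxEnt d)
  rw [show star w ⬝ᵥ maxEnt d = star (star (maxEnt d) ⬝ᵥ w) by
    rw [Matrix.star_dotProduct, dotProduct_comm]]
  simp [Complex.normSq_apply]

/-- The variance bound is applied to each Kraus operator separately, with mean `d⁻¹ * tr K`; the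
squared moduli of these means add up to the entanglement fidelity. -/
lemma entFidelity_smul_le_twirl {κ : Type*} [Fintype κ] [Nonempty κ]
    {U : κ → Matrix (Fin d) (Fin d) ℂ} (hκ : Fintype.card κ = d * d)
    (hU : ∀ K : Matrix (Fin d) (Fin d) ℂ, ∑ z, (U z)ᴴ * K * U z = ((d : ℂ) * K.trace) • 1)
    {M : SuperOp (Fin d) (Fin d)} (hM : IsCompletelyPositive M) {r : ℕ}
    {ρ : Matrix (Fin r × Fin d) (Fin r × Fin d) ℂ} (hρ : ρ.PosSemidef) :
    (entFidelity M : ℂ) • ρ ≤ ampliation (Fin r) (twirl U M) ρ := by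
  obtain ⟨K, rfl⟩ := exists_kraus hM
  have htw : twirl U (∑ k, conjMap (K k)) = ∑ k, ∑ z,
      ((((Fintype.card κ : ℝ)⁻¹ : ℝ)) : ℂ) • conjMap ((U z)ᴴ * K k * U z) := by
    rw [map_sum]
    refine Finset.sum_congr rfl fun k _ => Finset.sum_congr rfl fun z _ => ?_
    congr 1
    ext1 X
    simp [conjMap_apply, Matrix.conjTranspose_mul, mul_assoc]
  rw [htw, ampliation_sum, entFidelity_sum_conjMap, Complex.ofReal_sum, Finset.sum_smul]
  refine Finset.sum_le_sum fun k _ => ?_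
  rw [ampliation_sum]
  simp only [ampliation_smul, ampliation_conjMap]
  refine smul_le_sum_conj (fun _ => by positivity) (by simp) ?_ hρ
  rw [← Finset.smul_sum]
  have hs : ∑ z, (1 : Matrix (Fin r) (Fin r) ℂ) ⊗ₖ ((U z)ᴴ * K k * U z) =
      (1 : Matrix (Fin r) (Fin r) ℂ) ⊗ₖ ∑ z, (U z)ᴴ * K k * U z := by
    ext x y
    simp only [Matrix.sum_apply, Matrix.kroneckerMap_apply, Finset.mul_sum]
  rw [hs, hU, Matrix.kronecker_smul, Matrix.one_kronecker_one, smul_smul, hκ]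
  congr 1
  have := NeZero.ne (d : ℂ)
  push_cast
  field_simp

end EntFidelity

/-! ### Bounds on the two errors -/

section Errors

variable {d : ℕ} [NeZero d]

lemma traceNorm_sub_le_two {ι : Type*} [Fintype ι] [DecidableEq ι] {ω τ : Matrix ι ι ℂ}
    (hω : IsState ω) (hτ : IsState τ) : traceNorm (ω - τ) ≤ 2 := by
  have := traceNorm_sub_le hω.posSemidef hτ.posSemidef
  rw [hω.trace_eq_one, hτ.trace_eq_one] at this
  norm_num at this
  exact this

lemma one_sub_entFidelity_le_half_diamondDist {M : SuperOp (Fin d) (Fin d)} (hM : IsChannel M) :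
    1 - entFidelity M ≤ 1 / 2 * diamondDist LinearMap.id M := by
  have hle : traceNorm (ampliation (Fin d) LinearMap.id
      (Matrix.vecMulVec (maxEnt d) (star (maxEnt d))) - ampliation (Fin d) M
      (Matrix.vecMulVec (maxEnt d) (star (maxEnt d)))) ≤ diamondDist LinearMap.id M := by
    -- The real supremum is meaningful only for a bounded set; trace distances of states are at most
    -- `2`.
    refine le_csSup ⟨2, ?_⟩ ⟨d, _, isState_maxEnt, rfl⟩
    rintro t ⟨r, ρ, hρ, rfl⟩
    exact traceNorm_sub_le_two hρ (hM.isState_ampliation hρ)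
  have h := two_mul_one_sub_le_traceNorm star_maxEnt_dotProduct
    (hM.isState_ampliation isState_maxEnt).trace_eq_one
  rw [ampliation_id] at hle
  have := h.trans hle
  unfold entFidelity
  linarith

lemma channelFidelity_id_le_entFidelity {M : SuperOp (Fin d) (Fin d)} (hM : IsChannel M) :
    channelFidelity LinearMap.id M ≤ entFidelity M := by
  refine csInf_le ⟨0, ?_⟩ ⟨d, _, isState_maxEnt, ?_⟩
  · rintro t ⟨r, ρ, hρ, rfl⟩
    exact sq_nonneg _
  · rw [ampliation_id, fidelity_vecMulVec star_maxEnt_dotProduct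
      (hM.isState_ampliation isState_maxEnt).posSemidef]
    rfl

lemma entFidelity_nonneg {M : SuperOp (Fin d) (Fin d)} (hM : IsChannel M) :
    0 ≤ entFidelity M :=
  (Complex.le_def.mp
    ((hM.isState_ampliation isState_maxEnt).posSemidef.dotProduct_mulVec_nonneg _)).1

variable {M' : SuperOp (Fin d) (Fin d)} {f : ℝ}

lemma le_one_of_smul_le_ampliation (hM' : IsChannel M')
    (h : ∀ (r : ℕ) (ρ : Matrix (Fin r × Fin d) (Fin r × Fin d) ℂ), IsState ρ →
      (f : ℂ) • ρ ≤ ampliation (Fin r) M' ρ) : f ≤ 1 := by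
  have hp : Matrix.PosSemidef _ := h d _ isState_maxEnt
  have := (Complex.le_def.mp hp.trace_nonneg).1
  rw [Matrix.trace_sub, (hM'.isState_ampliation isState_maxEnt).trace_eq_one, Matrix.trace_smul,
    isState_maxEnt.trace_eq_one] at this
  simpa using this

lemma half_diamondDist_id_le (hM' : IsChannel M')
    (h : ∀ (r : ℕ) (ρ : Matrix (Fin r × Fin d) (Fin r × Fin d) ℂ), IsState ρ →
      (f : ℂ) • ρ ≤ ampliation (Fin r) M' ρ) :
    1 / 2 * diamondDist LinearMap.id M' ≤ 1 - f := by
  have hf1 := le_one_of_smul_le_ampliation hM' h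
  have : diamondDist LinearMap.id M' ≤ 2 * (1 - f) := by
    refine Real.sSup_le ?_ (by linarith)
    rintro t ⟨r, ρ, hρ, rfl⟩
    exact traceNorm_sub_le_of_smul_le hρ (hM'.isState_ampliation hρ) hf1 (h r ρ hρ)
  linarith

lemma le_channelFidelity_id (hf : 0 ≤ f)
    (h : ∀ (r : ℕ) (ρ : Matrix (Fin r × Fin d) (Fin r × Fin d) ℂ), IsState ρ →
      (f : ℂ) • ρ ≤ ampliation (Fin r) M' ρ) :
    f ≤ channelFidelity LinearMap.id M' := by
  refine le_csInf ⟨_, d, _, isState_maxEnt, rfl⟩ ?_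
  rintro t ⟨r, ρ, hρ, rfl⟩
  exact le_fidelity_of_smul_le hρ hf (h r ρ hρ)

end Errors

/-- The upper bound on `f` may be attained at another point `y`, which is what leaves room for
replacing a protocol by its twirl. -/
lemma sInf_image_eq_of_dominated {S : Type*} {s : Set S} {f g : S → ℝ}
    (hg : BddBelow (g '' s)) (hgf : ∀ x ∈ s, g x ≤ f x) (hfg : ∀ x ∈ s, ∃ y ∈ s, f y ≤ g x) :
    sInf (f '' s) = sInf (g '' s) := by
  rcases s.eq_empty_or_nonempty with rfl | hs
  · simp
  have hf : BddBelow (f '' s) := by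
    obtain ⟨b, hb⟩ := hg
    refine ⟨b, ?_⟩
    rintro _ ⟨x, hx, rfl⟩
    exact (hb ⟨x, hx, rfl⟩).trans (hgf x hx)
  refine le_antisymm (le_csInf (hs.image g) ?_) (le_csInf (hs.image f) ?_)
  · rintro _ ⟨x, hx, rfl⟩
    obtain ⟨y, hy, hyx⟩ := hfg x hx
    exact (csInf_le hf ⟨y, hy, rfl⟩).trans hyx
  · rintro _ ⟨x, hx, rfl⟩
    exact (csInf_le hg ⟨x, hx, rfl⟩).trans (hgf x hx)

/-- Twirling a simulation protocol by Weyl operators makes the simulated channel dominate the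
identity channel scaled by the entanglement fidelity of the original simulation. -/
lemma exists_mem_LOCR_entFidelity_smul_le {α β : Type*} [Fintype α] [Fintype β] {d : ℕ} [NeZero d]
    {N : SuperOp α β} (hN : IsChannel N) {Υ : SuperOp α β →ₗ[ℂ] SuperOp (Fin d) (Fin d)}
    (hΥ : Υ ∈ LOCR α β (Fin d) (Fin d)) :
    ∃ Υ' ∈ LOCR α β (Fin d) (Fin d),
      ∀ (r : ℕ) (ρ : Matrix (Fin r × Fin d) (Fin r × Fin d) ℂ), IsState ρ →
        (entFidelity (Υ N) : ℂ) • ρ ≤ ampliation (Fin r) (Υ' N) ρ := by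
  obtain ⟨U, hU, hU'⟩ := exists_unitary_design d
  refine ⟨twirl U ∘ₗ Υ, twirl_comp_mem_LOCR hU hΥ, fun r ρ hρ => ?_⟩
  exact entFidelity_smul_le_twirl (by simp [ZMod.card]) hU'
    (isChannel_of_mem_LOCR hΥ hN).completelyPositive hρ.posSemidef

end QChan

end

theorem proposition4 {Ahat Bhat : Type*} [Fintype Ahat] [Nonempty Ahat]
    [Fintype Bhat] [Nonempty Bhat] (d : ℕ) (hd : 1 ≤ d)
    (N : QChan.SuperOp Ahat Bhat) (hN : QChan.IsChannel N) :
    QChan.errLOCR d N = QChan.errLOCRF d N := by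
  have : NeZero d := ⟨by omega⟩
  have hch {Υ} (hΥ : Υ ∈ QChan.LOCR Ahat Bhat (Fin d) (Fin d)) : QChan.IsChannel (Υ N) :=
    QChan.isChannel_of_mem_LOCR hΥ hN
  have hbdd : BddBelow ((fun Υ : QChan.SuperOp Ahat Bhat →ₗ[ℂ] QChan.SuperOp (Fin d) (Fin d) =>
      1 - QChan.entFidelity (Υ N)) '' QChan.LOCR Ahat Bhat (Fin d) (Fin d)) := by
    refine ⟨0, ?_⟩
    rintro _ ⟨Υ, hΥ, rfl⟩
    obtain ⟨Υ', hΥ', h⟩ := QChan.exists_mem_LOCR_entFidelity_smul_le hN hΥ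
    exact sub_nonneg.mpr (QChan.le_one_of_smul_le_ampliation (hch hΥ') h)
  -- Each error is compared with `1 - entFidelity (Υ N)`, and the same twirled protocol serves for
  -- both.
  refine Eq.trans (QChan.sInf_image_eq_of_dominated hbdd (fun Υ hΥ => ?_) (fun Υ hΥ => ?_))
    (QChan.sInf_image_eq_of_dominated hbdd (fun Υ hΥ => ?_) (fun Υ hΥ => ?_)).symm
  · exact QChan.one_sub_entFidelity_le_half_diamondDist (hch hΥ)
  · obtain ⟨Υ', hΥ', h⟩ := QChan.exists_mem_LOCR_entFidelity_smul_le hN hΥ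
    exact ⟨Υ', hΥ', QChan.half_diamondDist_id_le (hch hΥ') h⟩
  · exact sub_le_sub_left (QChan.channelFidelity_id_le_entFidelity (hch hΥ)) 1
  · obtain ⟨Υ', hΥ', h⟩ := QChan.exists_mem_LOCR_entFidelity_smul_le hN hΥ
    exact ⟨Υ', hΥ', sub_le_sub_left
      (QChan.le_channelFidelity_id (QChan.entFidelity_nonneg (hch hΥ)) h) 1⟩
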